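/- Let $\mathbb{N}$ be the set of nonnegative integers. For $S\subseteq\mathbb{N}$ and $n\in\mathbb{N}$ let $R_S(n)$ be the number of pairs $(s,s')$ with $s,s'\in S$, $s<s'$ and $s+s'=n$, and let $S+1=\{s+1:s\in S\}$. For a sequence $h_1,h_2,\ldots$ of positive integers, let $H_0(h_1,h_2,\ldots)$ (respectively $H_1(h_1,h_2,\ldots)$) be the set of all sums $\sum_{i\in F}h_i$, where $F$ is a finite set of positive integers with $|F|$ even (respectively odd). For an integer $l\ge 0$, put $S_1(l)=H_0(h_1,h_2,\ldots)$ and $T_1(l)=H_1(h_1,h_2,\ldots)$, where $h_i=2^{i-1}$ for $1\le i\le l$ and $h_{l+1+j}=(2^l+1)2^j$ for $j\ge 0$. Let $S_2(l)=H_0(h'_1,h'_2,\ldots)$ and $T_2(l)=H_1(h'_1,h'_2,\ldots)$, where $h'_i=h_i$ for all $i\ne l$ and, if $l\ge 1$, $h'_l=2^{l-1}+1$ (so $S_2(0)=S_1(0)$ and $T_2(0)=T_1(0)$). Theorem 1.1. Let $m\ge 2$ and $r\ge 0$ be integers, and let $A,B$ be sets with $A\cup B=\mathbb{N}\setminus\{r+mk:k\in\mathbb{N}\}$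 and $A\cap B=\emptyset$. Then $R_A(n)=R_B(n)$ for every positive integer $n$ if and only if there is an integer $l\ge 0$ such that, up to interchanging $A$ and $B$, the pair $(A,B)$ is one of $(S_1(l),T_1(l))$, $(S_2(l),T_2(l))$, $(S_1(l)+1,T_1(l)+1)$. -/

import Mathlib

/-- `repr2 S n` is the number of representations `n = s + s'` with `s, s' ∈ S` and `s < s'`
(the function written `R_S(n)`). The set of such pairs is always finite. -/
noncomputable def repr2 (S : Set ℕ) (n : ℕ) : ℕ :=
  Set.ncard {p : ℕ × ℕ | p.1 ∈ S ∧ p.2 ∈ S ∧ p.1 < p.2 ∧ p.1 + p.2 = n}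

/-- `H₀(h)`: sums of an even number of terms of the sequence `h`, taken at distinct indices.
For a sequence of positive integers the sum `∑ εᵢ hᵢ` with `εᵢ ∈ {0, 1}` is finite exactly when
`{i | εᵢ = 1}` is a finite set, which is the `F` here; `∑ εᵢ` is then its cardinality. -/
def evenSums (h : ℕ → ℕ) : Set ℕ :=
  {n | ∃ F : Finset ℕ, Even F.card ∧ ∑ i ∈ F, h i = n}

/-- `H₁(h)`: sums of an odd number of terms of the sequence `h`, taken at distinct indices. -/
def oddSums (h : ℕ → ℕ) : Set ℕ :=
  {n | ∃ F : Finset ℕ, Odd F.card ∧ ∑ i ∈ F, h i = n}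

/-- `1, 2, 4, …, 2 ^ (l - 1)`, followed by `2 ^ l + 1, 2 (2 ^ l + 1), 4 (2 ^ l + 1), …`.
Indices start at `0`, so that the term `h_{i+1}` of the mathematical text is `seq1 l i`. -/
def seq1 (l i : ℕ) : ℕ :=
  if i < l then 2 ^ i else (2 ^ l + 1) * 2 ^ (i - l)

/-- The same sequence with its `l`-th term `2 ^ (l - 1)` replaced by `2 ^ (l - 1) + 1`;
for `l = 0` there is no such term and nothing changes. -/
def seq2 (l i : ℕ) : ℕ :=
  if i + 1 = l then 2 ^ i + 1 else seq1 l i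

def S1 (l : ℕ) : Set ℕ := evenSums (seq1 l)

def T1 (l : ℕ) : Set ℕ := oddSums (seq1 l)

def S2 (l : ℕ) : Set ℕ := evenSums (seq2 l)

def T2 (l : ℕ) : Set ℕ := oddSums (seq2 l)

/-- The translate `S + 1`. -/
def shiftOne (S : Set ℕ) : Set ℕ := (fun s => s + 1) '' S

/-- The ordered pair `(A, B)` is one of the three pairs with parameter `l`. -/
def IsListedPair (l : ℕ) (A B : Set ℕ) : Prop :=
  (A = S1 l ∧ B = T1 l) ∨ (A = S2 l ∧ B = T2 l) ∨
    (A = shiftOne (S1 l) ∧ B = shiftOne (T1 l))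

/-! Put `F = ∑ (1_A - 1_B)(n) xⁿ` and `G = ∑ 1_U(n) xⁿ`, where `U = A ∪ B`. Since the square of the
generating function of `S` is `2 ∑ R_S(n) xⁿ` plus that function at `x²`, equality of the
representation functions yields `F(x) G(x) = F(x²)`. If `0 ∈ U`, this equation determines `F` from
`F(0) = ±1`, so a set `U` admits at most one such partition up to order (`partition_unique`). It
remains to exhibit partitions for some `U` and to exclude the other `U`.

Existence: if the subset sums of `h` are distinct, moving one index between two index sets matches
even pairs with odd pairs (`repr2_evenSums_eq`). Binary digits show which residue class the sums
miss.

Exclusion, for `r ≥ 1`: with `P = 1 + ⋯ + z^(m-1) - z^r` the equation becomes `F(z) P(z) = F(z²) (1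
- z^m)` for `|z| < 1`. A zero of `F` would propagate along `z, z², z⁴, …` to `0`, so `F`, and hence
`P`, has no zero in the disc. The end coefficients of `P` are `±1`, so its roots lie on the unit
circle and `P` is palindromic, whence `m = r + 1` or `m = 2r + 1` (`eq_of_gapPoly_ne_zero`). If `r`
had an odd divisor `d > 1`, the nontrivial `d`-th roots of unity would be zeros of `P`, and `F`
would grow near them faster than `1 / (1 - |z|)` (`GapEq.false_of_roots`). So `r` is a power of `2`.
The case `r = 0` is the case `r = m - 1` translated by one. -/

/-! ### Representation functions as convolutions; the functional equation -/

open Finset in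
theorem repr2_eq_sum (S : Set ℕ) (n : ℕ) :
    (repr2 S n : ℤ) = ∑ p ∈ HasAntidiagonal.antidiagonal n,
      if p.1 < p.2 then S.indicator (1 : ℕ → ℤ) p.1 * S.indicator 1 p.2 else 0 := by
  classical
  have h : {p : ℕ × ℕ | p.1 ∈ S ∧ p.2 ∈ S ∧ p.1 < p.2 ∧ p.1 + p.2 = n} =
      ((HasAntidiagonal.antidiagonal n).filter fun p => p.1 ∈ S ∧ p.2 ∈ S ∧ p.1 < p.2 : Finset (ℕ × ℕ)) := by
    ext p
    simp only [Set.mem_ofPred_eq, coe_filter, HasAntidiagonal.mem_antidiagonal]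
    tauto
  rw [repr2, h, Set.ncard_coe_finset, card_filter]
  push_cast
  refine sum_congr rfl fun p _ => ?_
  by_cases h1 : p.1 ∈ S <;> by_cases h2 : p.2 ∈ S <;> simp [h1, h2]

open Finset in
theorem sum_antidiagonal_diag (w : ℕ → ℤ) (n : ℕ) :
    (∑ p ∈ HasAntidiagonal.antidiagonal n, if p.1 = p.2 then w p.1 else 0) =
      if Even n then w (n / 2) else 0 := by
  split_ifs with hn
  · obtain ⟨k, rfl⟩ := hn
    have hk : (k + k) / 2 = k := by omega
    rw [hk, sum_eq_single (k, k)]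
    · simp
    · rintro ⟨a, b⟩ hab hne
      rw [HasAntidiagonal.mem_antidiagonal] at hab
      rw [if_neg]
      intro h
      apply hne
      simp only at hab h
      ext <;> simp only <;> omega
    · intro h
      simp at h
  · refine sum_eq_zero ?_
    rintro ⟨a, b⟩ hab
    rw [HasAntidiagonal.mem_antidiagonal] at hab
    rw [if_neg]
    intro h
    simp only at hab h
    exact hn ⟨a, by omega⟩

open Finset in
/-- The number of ordered pairs in `S` with sum `n`, in terms of `repr2`. -/
theorem sum_indicator_mul_indicator (S : Set ℕ) (n : ℕ) :
    ∑ p ∈ HasAntidiagonal.antidiagonal n, S.indicator (1 : ℕ → ℤ) p.1 * S.indicator 1 p.2 =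
      2 * repr2 S n + if Even n then S.indicator 1 (n / 2) else 0 := by
  have hsq : ∀ k, S.indicator (1 : ℕ → ℤ) k * S.indicator 1 k = S.indicator 1 k := by
    intro k
    by_cases h : k ∈ S <;> simp [h]
  have hswap : (repr2 S n : ℤ) = ∑ p ∈ HasAntidiagonal.antidiagonal n,
      if p.2 < p.1 then S.indicator (1 : ℕ → ℤ) p.2 * S.indicator 1 p.1 else 0 := by
    rw [repr2_eq_sum, ← Finset.Nat.sum_antidiagonal_swap]
    rfl
  rw [← sum_antidiagonal_diag, two_mul]
  nth_rewrite 2 [hswap]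
  rw [repr2_eq_sum, ← sum_add_distrib, ← sum_add_distrib]
  refine sum_congr rfl fun p _ => ?_
  rcases lt_trichotomy p.1 p.2 with h | h | h
  · rw [if_pos h, if_neg h.not_gt, if_neg h.ne]
    ring
  · rw [if_neg h.not_lt, if_neg h.not_gt, if_pos h, ← h, hsq]
    ring
  · rw [if_neg h.not_gt, if_pos h, if_neg h.ne']
    ring

/-- `1_A - 1_B` -/
noncomputable def signFn (A B : Set ℕ) (n : ℕ) : ℤ :=
  A.indicator (1 : ℕ → ℤ) n - B.indicator (1 : ℕ → ℤ) n

/-- The functional equation `F(x) G(x) = F(x²)` on coefficients. -/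
def ConvEq (f g : ℕ → ℤ) : Prop :=
  ∀ n, ∑ p ∈ Finset.HasAntidiagonal.antidiagonal n, f p.1 * g p.2 = if Even n then f (n / 2) else 0

-- `(F_A - F_B)(F_A + F_B) = F_A² - F_B²`: the mixed terms cancel by symmetry, the `repr2` terms by
-- hypothesis, and only the diagonal terms survive.
open Finset in
theorem convEq_of_repr2_eq {A B : Set ℕ} (h : ∀ n, repr2 A n = repr2 B n) :
    ConvEq (signFn A B) fun n => A.indicator 1 n + B.indicator 1 n := by
  intro n
  have e : ∑ p ∈ HasAntidiagonal.antidiagonal n,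
      signFn A B p.1 * (A.indicator (1 : ℕ → ℤ) p.2 + B.indicator 1 p.2) =
      (∑ p ∈ HasAntidiagonal.antidiagonal n, A.indicator (1 : ℕ → ℤ) p.1 * A.indicator 1 p.2) -
      (∑ p ∈ HasAntidiagonal.antidiagonal n, B.indicator (1 : ℕ → ℤ) p.1 * B.indicator 1 p.2) +
      ((∑ p ∈ HasAntidiagonal.antidiagonal n, A.indicator (1 : ℕ → ℤ) p.1 * B.indicator 1 p.2) -
      (∑ p ∈ HasAntidiagonal.antidiagonal n, B.indicator (1 : ℕ → ℤ) p.1 * A.indicator 1 p.2)) := by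
    rw [← sum_sub_distrib, ← sum_sub_distrib, ← sum_add_distrib]
    refine sum_congr rfl fun p _ => ?_
    rw [signFn]
    ring
  have e2 : ∑ p ∈ HasAntidiagonal.antidiagonal n, A.indicator (1 : ℕ → ℤ) p.1 * B.indicator 1 p.2 =
      ∑ p ∈ HasAntidiagonal.antidiagonal n, B.indicator (1 : ℕ → ℤ) p.1 * A.indicator 1 p.2 := by
    rw [← Finset.Nat.sum_antidiagonal_swap]
    refine sum_congr rfl fun p _ => ?_
    rw [mul_comm, Prod.fst_swap, Prod.snd_swap]
  rw [e, e2, sum_indicator_mul_indicator, sum_indicator_mul_indicator, h n]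
  split_ifs <;> simp [signFn]

-- For `n > 0` the `n`-th equation is a recursion: `f n` occurs once, with coefficient `g 0 = 1`,
-- and every other value of `f`, including `f (n / 2)`, has a smaller index.
open Finset in
theorem ConvEq.unique {f f' g : ℕ → ℤ} (hf : ConvEq f g) (hf' : ConvEq f' g) (hg : g 0 = 1)
    (h0 : f 0 = f' 0) : f = f' := by
  funext n
  induction n using Nat.strong_induction_on with
  | _ n ih =>
    rcases Nat.eq_zero_or_pos n with rfl | hn
    · exact h0
    have h1 := hf n
    have h2 := hf' n
    have hr : (if Even n then f (n / 2) else 0) = if Even n then f' (n / 2) else 0 := by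
      rw [ih (n / 2) (by omega)]
    rw [← sum_erase_add _ _ (show (n, 0) ∈ HasAntidiagonal.antidiagonal n by simp)] at h1 h2
    have hs : ∑ p ∈ (HasAntidiagonal.antidiagonal n).erase (n, 0), f p.1 * g p.2 =
        ∑ p ∈ (HasAntidiagonal.antidiagonal n).erase (n, 0), f' p.1 * g p.2 := by
      refine sum_congr rfl ?_
      rintro ⟨a, b⟩ hp
      rw [mem_erase, HasAntidiagonal.mem_antidiagonal] at hp
      have : a < n := by
        by_contra hlt
        apply hp.1
        have h3 := hp.2
        simp only at h3
        ext <;> simp <;> omega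
      simp only [ih a this]
    simp only [hg, mul_one] at h1 h2
    linarith

theorem eq_of_signFn_eq {A B C D : Set ℕ} (hAB : A ∩ B = ∅) (hCD : C ∩ D = ∅)
    (h : signFn A B = signFn C D) : A = C ∧ B = D := by
  have key : ∀ n, (n ∈ A ↔ n ∈ C) ∧ (n ∈ B ↔ n ∈ D) := by
    intro n
    have h1 : ¬(n ∈ A ∧ n ∈ B) := fun hn => by
      have : n ∈ A ∩ B := hn
      simp [hAB] at this
    have h2 : ¬(n ∈ C ∧ n ∈ D) := fun hn => by
      have : n ∈ C ∩ D := hn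
      simp [hCD] at this
    have h3 := congrFun h n
    by_cases a : n ∈ A <;> by_cases b : n ∈ B <;> by_cases c : n ∈ C <;> by_cases d : n ∈ D <;>
      simp_all [signFn]
  exact ⟨Set.ext fun n => (key n).1, Set.ext fun n => (key n).2⟩

theorem indicator_add_indicator {A B U : Set ℕ} (hU : A ∪ B = U) (hAB : A ∩ B = ∅) (n : ℕ) :
    A.indicator (1 : ℕ → ℤ) n + B.indicator 1 n = U.indicator 1 n := by
  have h := Set.indicator_union_of_disjoint (Set.disjoint_iff_inter_eq_empty.2 hAB) (1 : ℕ → ℤ)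
  rw [← hU, h]

/-- A partition of `U` with equal representation functions is determined by the part of `0`. -/
theorem partition_unique {A B C D U : Set ℕ} (hU : (0 : ℕ) ∈ U) (hAB : A ∪ B = U)
    (hAB' : A ∩ B = ∅) (hCD : C ∪ D = U) (hCD' : C ∩ D = ∅) (h : ∀ n, repr2 A n = repr2 B n)
    (h' : ∀ n, repr2 C n = repr2 D n) (hA : 0 ∈ A) (hC : 0 ∈ C) : A = C ∧ B = D := by
  have hB : 0 ∉ B := fun hb => by
    have : 0 ∈ A ∩ B := ⟨hA, hb⟩
    simp [hAB'] at this
  have hD : 0 ∉ D := fun hb => by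
    have : 0 ∈ C ∩ D := ⟨hC, hb⟩
    simp [hCD'] at this
  have e1 := convEq_of_repr2_eq h
  have e2 := convEq_of_repr2_eq h'
  simp only [indicator_add_indicator hAB hAB', indicator_add_indicator hCD hCD'] at e1 e2
  refine eq_of_signFn_eq hAB' hCD' (e1.unique e2 (by simp [hU]) ?_)
  simp [signFn, hA, hB, hC, hD]

/-! ### Translation by one -/

theorem repr2_zero (S : Set ℕ) : repr2 S 0 = 0 := by
  have : {p : ℕ × ℕ | p.1 ∈ S ∧ p.2 ∈ S ∧ p.1 < p.2 ∧ p.1 + p.2 = 0} = ∅ := by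
    ext p
    simp only [Set.mem_ofPred_eq, Set.mem_empty_iff_false, iff_false]
    omega
  rw [repr2, this, Set.ncard_empty]

theorem repr2_shiftOne_add_two (S : Set ℕ) (n : ℕ) : repr2 (shiftOne S) (n + 2) = repr2 S n := by
  have hinj : Function.Injective fun p : ℕ × ℕ => (p.1 + 1, p.2 + 1) := by
    rintro ⟨a, b⟩ ⟨c, d⟩ h
    simpa using h
  symm
  rw [repr2, ← Set.ncard_image_of_injective _ hinj, repr2]
  congr 1
  symm
  ext ⟨a, b⟩
  simp only [Set.mem_ofPred_eq, shiftOne, Set.mem_image, Prod.mk.injEq, Prod.exists]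
  constructor
  · rintro ⟨⟨s, hs, rfl⟩, ⟨t, ht, rfl⟩, h1, h2⟩
    exact ⟨s, t, ⟨hs, ht, by omega, by omega⟩, rfl, rfl⟩
  · rintro ⟨s, t, ⟨hs, ht, h1, h2⟩, rfl, rfl⟩
    exact ⟨⟨s, hs, rfl⟩, ⟨t, ht, rfl⟩, by omega, by omega⟩

theorem repr2_shiftOne_one (S : Set ℕ) : repr2 (shiftOne S) 1 = 0 := by
  have : {p : ℕ × ℕ | p.1 ∈ shiftOne S ∧ p.2 ∈ shiftOne S ∧ p.1 < p.2 ∧ p.1 + p.2 = 1} = ∅ := by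
    ext ⟨a, b⟩
    simp only [Set.mem_ofPred_eq, Set.mem_empty_iff_false, iff_false, shiftOne, Set.mem_image]
    rintro ⟨⟨s, -, rfl⟩, ⟨t, -, rfl⟩, h1, h2⟩
    omega
  rw [repr2, this, Set.ncard_empty]

theorem repr2_shiftOne_congr {S T : Set ℕ} (h : ∀ n, repr2 S n = repr2 T n) (n : ℕ) :
    repr2 (shiftOne S) n = repr2 (shiftOne T) n := by
  match n with
  | 0 => rw [repr2_zero, repr2_zero]
  | 1 => rw [repr2_shiftOne_one, repr2_shiftOne_one]
  | n + 2 => rw [repr2_shiftOne_add_two, repr2_shiftOne_add_two, h]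

/-! ### Even and odd subset sums -/

-- Ordered pairs are needed because `toggle` need not respect the order of the two sums.
open Finset in
theorem two_mul_repr2 (S : Set ℕ) (n : ℕ) :
    2 * repr2 S n = Set.ncard {p : ℕ × ℕ | p.1 ∈ S ∧ p.2 ∈ S ∧ p.1 ≠ p.2 ∧ p.1 + p.2 = n} := by
  set X := {p : ℕ × ℕ | p.1 ∈ S ∧ p.2 ∈ S ∧ p.1 < p.2 ∧ p.1 + p.2 = n} with hX
  have hfin : X.Finite := (HasAntidiagonal.antidiagonal n).finite_toSet.subset fun p hp => by
    simpa using hp.2.2.2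
  have hu : {p : ℕ × ℕ | p.1 ∈ S ∧ p.2 ∈ S ∧ p.1 ≠ p.2 ∧ p.1 + p.2 = n} =
      X ∪ Prod.swap '' X := by
    ext ⟨a, b⟩
    simp only [hX, Set.mem_ofPred_eq, Set.mem_union, Set.mem_image, Prod.exists, Prod.swap_prod_mk,
      Prod.mk.injEq]
    constructor
    · rintro ⟨ha, hb, hne, hs⟩
      rcases hne.lt_or_gt with h | h
      · exact Or.inl ⟨ha, hb, h, hs⟩
      · exact Or.inr ⟨b, a, ⟨hb, ha, h, by omega⟩, rfl, rfl⟩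
    · rintro (⟨ha, hb, h, hs⟩ | ⟨_, _, ⟨hb, ha, h, hs⟩, rfl, rfl⟩)
      · exact ⟨ha, hb, h.ne, hs⟩
      · exact ⟨ha, hb, h.ne', by omega⟩
  rw [hu, Set.ncard_union_eq _ hfin (hfin.image _),
    Set.ncard_image_of_injective _ Prod.swap_injective, two_mul, repr2]
  rw [Set.disjoint_left]
  rintro ⟨a, b⟩ ⟨-, -, h, -⟩ ⟨⟨c, d⟩, ⟨-, -, h', -⟩, e⟩
  simp only [Prod.swap_prod_mk, Prod.mk.injEq] at e h h'
  omega

open Finset symmDiff in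
theorem symmDiff_singleton_of_mem {F : Finset ℕ} {i : ℕ} (h : i ∈ F) : F ∆ {i} = F.erase i := by
  ext a
  simp only [mem_symmDiff, mem_singleton, mem_erase]
  constructor
  · rintro (h | ⟨rfl, h2⟩)
    · exact ⟨h.2, h.1⟩
    · exact absurd h h2
  · exact fun h => Or.inl ⟨h.2, h.1⟩

open Finset symmDiff in
theorem symmDiff_singleton_of_notMem {F : Finset ℕ} {i : ℕ} (h : i ∉ F) :
    F ∆ {i} = insert i F := by
  ext a
  simp only [mem_symmDiff, mem_singleton, mem_insert]
  constructor
  · rintro (h | h)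
    · exact Or.inr h.1
    · exact Or.inl h.1
  · rintro (rfl | h2)
    · exact Or.inr ⟨rfl, h⟩
    · exact Or.inl ⟨h2, by rintro rfl; exact h h2⟩

open Finset symmDiff in
theorem even_card_symmDiff_singleton (F : Finset ℕ) (i : ℕ) :
    Even (F ∆ {i}).card ↔ Odd F.card := by
  by_cases h : i ∈ F
  · rw [symmDiff_singleton_of_mem h, ← card_erase_add_one h, Nat.odd_add_one, Nat.not_odd_iff_even]
  · rw [symmDiff_singleton_of_notMem h, card_insert_of_notMem h, Nat.even_add_one,
      Nat.not_even_iff_odd]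

open Finset symmDiff in
/-- Move the least element of the symmetric difference of two finite sets to the other set. -/
noncomputable def toggle (p : Finset ℕ × Finset ℕ) : Finset ℕ × Finset ℕ :=
  (p.1 ∆ {sInf (↑(p.1 ∆ p.2) : Set ℕ)}, p.2 ∆ {sInf (↑(p.1 ∆ p.2) : Set ℕ)})

open symmDiff in
theorem symmDiff_toggle (p : Finset ℕ × Finset ℕ) :
    (toggle p).1 ∆ (toggle p).2 = p.1 ∆ p.2 := by
  rw [toggle, symmDiff_symmDiff_symmDiff_comm, symmDiff_self, symmDiff_bot]

open symmDiff in
-- The symmetric difference is unchanged, so the second application uses the same index. This covers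
-- `p.1 = p.2` too, where the index is the default `sInf ∅ = 0`.
theorem toggle_involutive : Function.Involutive toggle := by
  intro p
  ext1
  · rw [toggle, symmDiff_toggle]
    simp only [toggle, symmDiff_symmDiff_cancel_right]
  · rw [toggle, symmDiff_toggle]
    simp only [toggle, symmDiff_symmDiff_cancel_right]

open Finset symmDiff in
theorem toggle_sum (h : ℕ → ℕ) {p : Finset ℕ × Finset ℕ} (hp : p.1 ≠ p.2) :
    ∑ i ∈ (toggle p).1, h i + ∑ i ∈ (toggle p).2, h i = ∑ i ∈ p.1, h i + ∑ i ∈ p.2, h i := by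
  have hne : (↑(p.1 ∆ p.2) : Set ℕ).Nonempty := by
    rw [coe_nonempty, nonempty_iff_ne_empty, ← bot_eq_empty, Ne, symmDiff_eq_bot]
    exact hp
  have hi := Nat.sInf_mem hne
  simp only [toggle]
  generalize sInf (↑(p.1 ∆ p.2) : Set ℕ) = i at hi
  rw [mem_coe, mem_symmDiff] at hi
  rcases hi with ⟨h1, h2⟩ | ⟨h1, h2⟩
  · rw [symmDiff_singleton_of_mem h1, symmDiff_singleton_of_notMem h2, sum_insert h2,
      ← add_sum_erase _ _ h1]
    omega
  · rw [symmDiff_singleton_of_mem h1, symmDiff_singleton_of_notMem h2, sum_insert h2,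
      ← add_sum_erase _ _ h1]
    omega

/-- By injectivity, pairs of distinct summands are pairs of distinct index sets. On these `toggle`
keeps the total sum and flips both parities. -/
theorem repr2_evenSums_eq {h : ℕ → ℕ}
    (hinj : Function.Injective fun F : Finset ℕ => ∑ i ∈ F, h i) (n : ℕ) :
    repr2 (evenSums h) n = repr2 (oddSums h) n := by
  have hinj2 : Function.Injective fun p : Finset ℕ × Finset ℕ =>
      (∑ i ∈ p.1, h i, ∑ i ∈ p.2, h i) := hinj.prodMap hinj
  have himg : ∀ P : ℕ → Prop, {p : ℕ × ℕ | (∃ F : Finset ℕ, P F.card ∧ ∑ i ∈ F, h i = p.1) ∧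
      (∃ F : Finset ℕ, P F.card ∧ ∑ i ∈ F, h i = p.2) ∧ p.1 ≠ p.2 ∧ p.1 + p.2 = n} =
      (fun p : Finset ℕ × Finset ℕ => (∑ i ∈ p.1, h i, ∑ i ∈ p.2, h i)) ''
        {p | P p.1.card ∧ P p.2.card ∧ p.1 ≠ p.2 ∧ ∑ i ∈ p.1, h i + ∑ i ∈ p.2, h i = n} := by
    intro P
    ext ⟨a, b⟩
    simp only [Set.mem_ofPred_eq, Set.mem_image, Prod.mk.injEq, Prod.exists]
    constructor
    · rintro ⟨⟨F, hF, rfl⟩, ⟨F', hF', rfl⟩, hne, hs⟩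
      exact ⟨F, F', ⟨hF, hF', fun e => hne (by rw [e]), hs⟩, rfl, rfl⟩
    · rintro ⟨F, F', ⟨hF, hF', hne, hs⟩, rfl, rfl⟩
      exact ⟨⟨F, hF, rfl⟩, ⟨F', hF', rfl⟩, fun e => hne (hinj e), hs⟩
  have htog : {p : Finset ℕ × Finset ℕ | Even p.1.card ∧ Even p.2.card ∧ p.1 ≠ p.2 ∧
      ∑ i ∈ p.1, h i + ∑ i ∈ p.2, h i = n} = toggle ''
      {p : Finset ℕ × Finset ℕ | Odd p.1.card ∧ Odd p.2.card ∧ p.1 ≠ p.2 ∧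
      ∑ i ∈ p.1, h i + ∑ i ∈ p.2, h i = n} := by
    rw [toggle_involutive.image_eq_preimage_symm]
    ext p
    simp only [Set.mem_ofPred_eq, Set.mem_preimage]
    have h1 : (toggle p).1 ≠ (toggle p).2 ↔ p.1 ≠ p.2 := by
      rw [Ne, ← symmDiff_eq_bot, symmDiff_toggle, symmDiff_eq_bot]
    have h2 : ∀ q, Even (toggle q).1.card ↔ Odd q.1.card := fun q =>
      even_card_symmDiff_singleton _ _
    have h3 : ∀ q, Even (toggle q).2.card ↔ Odd q.2.card := fun q =>
      even_card_symmDiff_singleton _ _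
    rw [h1, ← h2, ← h3, toggle_involutive]
    refine and_congr_right fun _ => and_congr_right fun _ => and_congr_right fun hne => ?_
    rw [toggle_sum h hne]
  have e : 2 * repr2 (evenSums h) n = 2 * repr2 (oddSums h) n := by
    rw [two_mul_repr2, two_mul_repr2]
    simp only [evenSums, oddSums, Set.mem_ofPred_eq]
    rw [himg Even, himg Odd, Set.ncard_image_of_injective _ hinj2,
      Set.ncard_image_of_injective _ hinj2, htog,
      Set.ncard_image_of_injective _ toggle_involutive.injective]
  omega

theorem evenSums_inter_oddSums {h : ℕ → ℕ}
    (hinj : Function.Injective fun F : Finset ℕ => ∑ i ∈ F, h i) :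
    evenSums h ∩ oddSums h = ∅ := by
  ext n
  simp only [Set.mem_inter_iff, Set.mem_empty_iff_false, iff_false]
  rintro ⟨⟨F, hF, rfl⟩, ⟨F', hF', e⟩⟩
  have : F' = F := hinj e
  rw [this, ← Nat.not_even_iff_odd] at hF'
  exact hF' hF

theorem evenSums_union_oddSums (h : ℕ → ℕ) :
    evenSums h ∪ oddSums h = Set.range fun F : Finset ℕ => ∑ i ∈ F, h i := by
  ext n
  constructor
  · rintro (⟨F, -, hF⟩ | ⟨F, -, hF⟩) <;> exact ⟨F, hF⟩
  · rintro ⟨F, hF⟩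
    rcases Nat.even_or_odd F.card with he | ho
    · exact Or.inl ⟨F, he, hF⟩
    · exact Or.inr ⟨F, ho, hF⟩

theorem zero_mem_evenSums (h : ℕ → ℕ) : 0 ∈ evenSums h := ⟨∅, by simp, by simp⟩

/-! ### Binary digits and the sums of the two sequences -/

open Finset in
theorem sum_two_pow_lt (F : Finset ℕ) (l : ℕ) : ∑ i ∈ F.filter (· < l), 2 ^ i < 2 ^ l := by
  have h : ∑ i ∈ F.filter (· < l), 2 ^ i ≤ ∑ i ∈ range l, 2 ^ i :=
    sum_le_sum_of_subset fun i hi => by simpa using (mem_filter.1 hi).2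
  have := Nat.geomSum_eq (le_refl 2) l
  have := Nat.one_le_two_pow (n := l)
  omega

-- The two sums share their digits; only the weight of the upper block `q` changes. Bijectivity of
-- binary expansion is thereby transferred to `seq1`.
open Finset in
theorem exists_digits_seq1 (l : ℕ) (F : Finset ℕ) : ∃ a q, a < 2 ^ l ∧
    ∑ i ∈ F, 2 ^ i = a + 2 ^ l * q ∧ ∑ i ∈ F, seq1 l i = a + (2 ^ l + 1) * q := by
  refine ⟨∑ i ∈ F.filter (· < l), 2 ^ i, ∑ i ∈ F.filter (¬ · < l), 2 ^ (i - l),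
    sum_two_pow_lt F l, ?_, ?_⟩
  · rw [← sum_filter_add_sum_filter_not F (· < l), mul_sum]
    congr 1
    refine sum_congr rfl fun i hi => ?_
    rw [mem_filter] at hi
    rw [← pow_add]
    congr 1
    omega
  · rw [← sum_filter_add_sum_filter_not F (· < l), mul_sum]
    congr 1
    · refine sum_congr rfl fun i hi => ?_
      rw [mem_filter] at hi
      rw [seq1, if_pos hi.2]
    · refine sum_congr rfl fun i hi => ?_
      rw [mem_filter] at hi
      rw [seq1, if_neg hi.2]

-- Here `e` is the digit at index `l`, the one place where `seq2 (l + 1)` and `seq1 (l + 1)` differ.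
open Finset in
theorem exists_digits_seq2 (l : ℕ) (F : Finset ℕ) : ∃ a e q, a < 2 ^ l ∧ e < 2 ∧
    ∑ i ∈ F, 2 ^ i = a + 2 ^ l * e + 2 ^ (l + 1) * q ∧
    ∑ i ∈ F, seq2 (l + 1) i = a + (2 ^ l + 1) * e + (2 ^ (l + 1) + 1) * q := by
  classical
  have hsplit : ∀ h : ℕ → ℕ, ∑ i ∈ F, h i = ∑ i ∈ F.filter (· < l), h i +
      (if l ∈ F then h l else 0) + ∑ i ∈ F.filter (l < ·), h i := by
    intro h
    rw [sum_filter, sum_filter, ← sum_ite_eq' F l h, ← sum_add_distrib, ← sum_add_distrib]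
    refine sum_congr rfl fun i _ => ?_
    rcases lt_trichotomy i l with h | h | h
    · simp [h, h.ne, h.not_gt]
    · simp [h]
    · simp [h, h.ne', h.not_gt]
  refine ⟨∑ i ∈ F.filter (· < l), 2 ^ i, if l ∈ F then 1 else 0,
    ∑ i ∈ F.filter (l < ·), 2 ^ (i - (l + 1)), sum_two_pow_lt F l, by split_ifs <;> simp, ?_, ?_⟩
  · rw [hsplit, mul_sum]
    congr 1
    · split_ifs <;> simp
    · refine sum_congr rfl fun i hi => ?_
      rw [mem_filter] at hi
      rw [← pow_add]
      congr 1
      omega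
  · rw [hsplit, mul_sum]
    congr 1
    · congr 1
      · refine sum_congr rfl fun i hi => ?_
        rw [mem_filter] at hi
        rw [seq2, if_neg (by omega), seq1, if_pos (by omega)]
      · split_ifs <;> simp [seq2]
    · refine sum_congr rfl fun i hi => ?_
      rw [mem_filter] at hi
      rw [seq2, if_neg (by omega), seq1, if_neg (by omega)]

theorem eq_of_add_mul_eq {M a b q q' : ℕ} (ha : a < M) (hb : b < M) (h : a + M * q = b + M * q') :
    a = b ∧ q = q' := by
  have h1 := congrArg (· % M) h
  have h2 := congrArg (· / M) h
  simp only [Nat.add_mul_mod_self_left, Nat.mod_eq_of_lt ha, Nat.mod_eq_of_lt hb] at h1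
  have hM : 0 < M := by omega
  simp only [Nat.add_mul_div_left _ _ hM, Nat.div_eq_of_lt ha, Nat.div_eq_of_lt hb] at h2
  omega

theorem two_pow_sum_injective : Function.Injective fun F : Finset ℕ => ∑ i ∈ F, 2 ^ i := by
  intro F F' h
  simpa using congrArg (fun n : ℕ => n.bitIndices.toFinset) h

theorem two_pow_sum_surjective (n : ℕ) : ∃ F : Finset ℕ, ∑ i ∈ F, 2 ^ i = n :=
  ⟨n.bitIndices.toFinset, by simp⟩

theorem seq1_sum_injective (l : ℕ) :
    Function.Injective fun F : Finset ℕ => ∑ i ∈ F, seq1 l i := by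
  intro F F' h
  obtain ⟨a, q, ha, h1, h2⟩ := exists_digits_seq1 l F
  obtain ⟨b, q', hb, h3, h4⟩ := exists_digits_seq1 l F'
  simp only [h2, h4] at h
  obtain ⟨rfl, rfl⟩ := eq_of_add_mul_eq (by omega) (by omega) h
  exact two_pow_sum_injective (h1.trans h3.symm)

theorem seq2_sum_injective (l : ℕ) :
    Function.Injective fun F : Finset ℕ => ∑ i ∈ F, seq2 l i := by
  rcases l with _ | l
  · simpa [seq2] using seq1_sum_injective 0
  intro F F' h
  obtain ⟨a, e, q, ha, he, h1, h2⟩ := exists_digits_seq2 l F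
  obtain ⟨b, e', q', hb, he', h3, h4⟩ := exists_digits_seq2 l F'
  simp only [h2, h4] at h
  have hp : 2 ^ (l + 1) = 2 * 2 ^ l := by ring
  obtain ⟨h5, rfl⟩ := eq_of_add_mul_eq (by interval_cases e <;> omega)
    (by interval_cases e' <;> omega) h
  have : a = b ∧ e = e' := by interval_cases e <;> interval_cases e' <;> omega
  obtain ⟨rfl, rfl⟩ := this
  exact two_pow_sum_injective (h1.trans h3.symm)

theorem range_seq1_sum (l : ℕ) : (Set.range fun F : Finset ℕ => ∑ i ∈ F, seq1 l i) =
    Set.univ \ {n | ∃ k, n = 2 ^ l + (2 ^ l + 1) * k} := by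
  ext n
  simp only [Set.mem_range, Set.mem_sdiff, Set.mem_univ, true_and, Set.mem_ofPred_eq]
  constructor
  · rintro ⟨F, hF⟩ ⟨k, hk⟩
    obtain ⟨a, q, ha, -, h2⟩ := exists_digits_seq1 l F
    have := eq_of_add_mul_eq (by omega) (by omega) (h2.symm.trans (hF.trans hk))
    omega
  · intro hn
    have hlt := Nat.mod_lt n (show 2 ^ l + 1 > 0 from Nat.succ_pos _)
    have hdm := Nat.mod_add_div n (2 ^ l + 1)
    have hne : n % (2 ^ l + 1) ≠ 2 ^ l :=
      fun h => hn ⟨n / (2 ^ l + 1), by rw [h] at hdm; exact hdm.symm⟩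
    obtain ⟨F, hF⟩ := two_pow_sum_surjective (n % (2 ^ l + 1) + 2 ^ l * (n / (2 ^ l + 1)))
    refine ⟨F, ?_⟩
    obtain ⟨a, q, ha, h1, h2⟩ := exists_digits_seq1 l F
    obtain ⟨h3, h4⟩ := eq_of_add_mul_eq ha (by omega) (h1.symm.trans hF)
    rw [h2, h3, h4, hdm]

/-- `a + (2 ^ l + 1) * e` runs over the residues below `2 ^ l` for `e = 0` and those above it for `e
= 1`, so exactly `2 ^ l` is skipped. -/
theorem range_seq2_sum (l : ℕ) : (Set.range fun F : Finset ℕ => ∑ i ∈ F, seq2 (l + 1) i) =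
    Set.univ \ {n | ∃ k, n = 2 ^ l + (2 ^ (l + 1) + 1) * k} := by
  have hp : 2 ^ (l + 1) = 2 * 2 ^ l := by ring
  ext n
  simp only [Set.mem_range, Set.mem_sdiff, Set.mem_univ, true_and, Set.mem_ofPred_eq]
  constructor
  · rintro ⟨F, hF⟩ ⟨k, hk⟩
    obtain ⟨a, e, q, ha, he, -, h2⟩ := exists_digits_seq2 l F
    have := eq_of_add_mul_eq (by interval_cases e <;> omega) (by omega)
      (h2.symm.trans (hF.trans hk))
    interval_cases e <;> omega
  · intro hn
    have hlt := Nat.mod_lt n (show 2 ^ (l + 1) + 1 > 0 from Nat.succ_pos _)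
    have hdm := Nat.mod_add_div n (2 ^ (l + 1) + 1)
    have hne : n % (2 ^ (l + 1) + 1) ≠ 2 ^ l :=
      fun h => hn ⟨n / (2 ^ (l + 1) + 1), by rw [h] at hdm; exact hdm.symm⟩
    generalize n % (2 ^ (l + 1) + 1) = ρ at *
    generalize n / (2 ^ (l + 1) + 1) = Q at *
    obtain ⟨b, e', hb, he', hρ⟩ : ∃ b e', b < 2 ^ l ∧ e' < 2 ∧ ρ = b + (2 ^ l + 1) * e' := by
      rcases lt_or_gt_of_ne hne with h | h
      · exact ⟨ρ, 0, h, by omega, by omega⟩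
      · exact ⟨ρ - (2 ^ l + 1), 1, by omega, by omega, by omega⟩
    obtain ⟨F, hF⟩ := two_pow_sum_surjective (b + 2 ^ l * e' + 2 ^ (l + 1) * Q)
    refine ⟨F, ?_⟩
    obtain ⟨a, e, q, ha, he, h1, h2⟩ := exists_digits_seq2 l F
    obtain ⟨h3, h4⟩ := eq_of_add_mul_eq (by interval_cases e <;> omega)
      (by interval_cases e' <;> omega) (h1.symm.trans hF)
    have : a = b ∧ e = e' := by interval_cases e <;> interval_cases e' <;> omega
    rw [h2, this.1, this.2, h4, ← hdm, hρ]

/-! ### Roots and symmetry of the gap polynomial -/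

open Polynomial in
/-- `1 + X + ⋯ + X ^ (m - 1) - X ^ r` -/
noncomputable def gapPoly (m r : ℕ) : ℂ[X] := ∑ i ∈ Finset.range m, X ^ i - X ^ r

open Polynomial in
theorem coeff_gapPoly (m r k : ℕ) :
    (gapPoly m r).coeff k = (if k < m then 1 else 0) - if k = r then 1 else 0 := by
  simp [gapPoly, coeff_X_pow]

open Polynomial in
theorem reverse_X_sub_C_of_norm_eq_one {a : ℂ} (ha : ‖a‖ = 1) :
    reverse (X - C a) = C (-a) * (X - C (starRingEnd ℂ a)) := by
  have h1 : reverse (X - C a) = 1 - C a * X := by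
    have hX : reverse (X : ℂ[X]) = 1 := by
      rw [← one_mul X, reverse_mul_X, ← C_1, reverse_C]
    rw [sub_eq_add_neg, ← C_neg, reverse_add_C, hX, natDegree_X, C_neg]
    ring
  have h2 : a * starRingEnd ℂ a = 1 := by
    rw [Complex.mul_conj, Complex.normSq_eq_norm_sq, ha]
    norm_num
  have h3 : C a * C (starRingEnd ℂ a) = (1 : ℂ[X]) := by rw [← C_mul, h2, C_1]
  rw [h1, C_neg]
  linear_combination (-1 : ℂ[X]) * h3

open Polynomial in
theorem reverse_prod_X_sub_C (s : Multiset ℂ) (hs : ∀ a ∈ s, ‖a‖ = 1) :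
    ∃ c, reverse (s.map fun a => X - C a).prod =
      C c * (s.map fun a => X - C (starRingEnd ℂ a)).prod := by
  induction s using Multiset.induction_on with
  | empty => exact ⟨1, by simpa using reverse_C (1 : ℂ)⟩
  | cons a s ih =>
    obtain ⟨c, hc⟩ := ih fun b hb => hs b (Multiset.mem_cons_of_mem hb)
    refine ⟨-a * c, ?_⟩
    rw [Multiset.map_cons, Multiset.prod_cons, Multiset.map_cons, Multiset.prod_cons,
      reverse_mul_of_domain, hc, reverse_X_sub_C_of_norm_eq_one (hs a (Multiset.mem_cons_self a s)),
      C_mul]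
    ring

open Polynomial in
/-- A polynomial with all roots on the unit circle is self-reciprocal up to conjugation. -/
theorem reverse_eq_of_roots_norm_eq_one (p : ℂ[X]) (hp : ∀ a ∈ p.roots, ‖a‖ = 1) :
    ∃ c, reverse p = C c * p.map (starRingEnd ℂ) := by
  have h := (IsAlgClosed.splits p).eq_prod_roots
  obtain ⟨c, hc⟩ := reverse_prod_X_sub_C p.roots hp
  by_cases hp0 : p = 0
  · exact ⟨0, by simp [hp0]⟩
  have hl : starRingEnd ℂ p.leadingCoeff ≠ 0 := by simpa using hp0
  have hm : p.map (starRingEnd ℂ) = C (starRingEnd ℂ p.leadingCoeff) *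
      (p.roots.map fun a => X - C (starRingEnd ℂ a)).prod := by
    conv_lhs => rw [h]
    rw [Polynomial.map_mul, Polynomial.map_multiset_prod, Multiset.map_map]
    simp
  refine ⟨p.leadingCoeff * c * (starRingEnd ℂ p.leadingCoeff)⁻¹, ?_⟩
  rw [hm]
  conv_lhs => rw [h]
  have e : C (starRingEnd ℂ p.leadingCoeff)⁻¹ * C (starRingEnd ℂ p.leadingCoeff) = 1 := by
    rw [← C_mul, inv_mul_cancel₀ hl, C_1]
  rw [reverse_mul_of_domain, reverse_C, hc, C_mul, C_mul]
  linear_combination (-C p.leadingCoeff * C c *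
    (p.roots.map fun a => X - C (starRingEnd ℂ a)).prod) * e

theorem one_le_norm_prod (s : Multiset ℂ) (hs : ∀ a ∈ s, 1 ≤ ‖a‖) : 1 ≤ ‖s.prod‖ := by
  induction s using Multiset.induction_on with
  | empty => simp
  | cons a s ih =>
    rw [Multiset.prod_cons, norm_mul]
    exact one_le_mul_of_one_le_of_one_le (hs a (Multiset.mem_cons_self a s))
      (ih fun b hb => hs b (Multiset.mem_cons_of_mem hb))

-- All roots have norm at least `1`, and their product has norm `1`.
open Polynomial in
theorem norm_root_eq_one {p : ℂ[X]} (h0 : ‖p.coeff 0‖ = 1) (hl : ‖p.leadingCoeff‖ = 1)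
    (hp : ∀ z, ‖z‖ < 1 → p.eval z ≠ 0) : ∀ a ∈ p.roots, ‖a‖ = 1 := by
  have hge : ∀ a ∈ p.roots, 1 ≤ ‖a‖ := by
    intro a ha
    by_contra hlt
    exact hp a (not_le.1 hlt) (mem_roots'.1 ha).2
  have h := (IsAlgClosed.splits p).coeff_zero_eq_leadingCoeff_mul_prod_roots
  have hprod : ‖p.roots.prod‖ = 1 := by
    rw [h] at h0
    simpa [hl] using h0
  intro a ha
  refine le_antisymm ?_ (hge a ha)
  obtain ⟨t, ht⟩ := Multiset.exists_cons_of_mem ha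
  have h1 : 1 ≤ ‖t.prod‖ := one_le_norm_prod t fun b hb =>
    hge b (by rw [ht]; exact Multiset.mem_cons_of_mem hb)
  rw [ht, Multiset.prod_cons, norm_mul] at hprod
  calc ‖a‖ = ‖a‖ * 1 := (mul_one _).symm
    _ ≤ ‖a‖ * ‖t.prod‖ := by gcongr
    _ = 1 := hprod

-- The coefficients are real, so `P` equals its reverse up to a constant, and evaluation at `1`,
-- where `P(1) = m - 1 ≠ 0`, shows the constant is `1`.
open Polynomial in
theorem reverse_gapPoly {m r : ℕ} (hm : 2 ≤ m) (hr : 1 ≤ r)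
    (hl : ‖(gapPoly m r).leadingCoeff‖ = 1) (hp : ∀ z, ‖z‖ < 1 → (gapPoly m r).eval z ≠ 0) :
    reverse (gapPoly m r) = gapPoly m r := by
  have h0 : (gapPoly m r).coeff 0 = 1 := by
    rw [coeff_gapPoly, if_pos (by omega), if_neg (by omega), sub_zero]
  obtain ⟨c, hc⟩ := reverse_eq_of_roots_norm_eq_one _
    (norm_root_eq_one (by rw [h0, norm_one]) hl hp)
  have hmap : (gapPoly m r).map (starRingEnd ℂ) = gapPoly m r := by
    simp [gapPoly, Polynomial.map_sum]
  rw [hmap] at hc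
  have h1 : (gapPoly m r).eval 1 = (m : ℂ) - 1 := by simp [gapPoly, eval_finsetSum]
  have hne : (m : ℂ) - 1 ≠ 0 := by
    rw [sub_ne_zero]
    exact_mod_cast (by omega : m ≠ 1)
  have hrev : (reverse (gapPoly m r)).eval 1 = (gapPoly m r).eval 1 := by
    let _ : Invertible (1 : ℂ) := invertibleOne
    have := eval₂_reverse_mul_pow (RingHom.id ℂ) 1 (gapPoly m r)
    simpa [eval₂_id] using this
  rw [hc, eval_mul, eval_C, h1] at hrev
  have : c = 1 := mul_right_cancel₀ hne (hrev.trans (one_mul _).symm)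
  rw [hc, this, C_1, one_mul]

-- In a palindrome the end coefficients agree, which excludes `m ≤ r`. If `r < m - 1`, the only
-- vanishing coefficient, at `r`, must be its own mirror image in degree `m - 1`.
open Polynomial in
theorem eq_of_gapPoly_ne_zero {m r : ℕ} (hm : 2 ≤ m) (hr : 1 ≤ r)
    (hp : ∀ z, ‖z‖ < 1 → (gapPoly m r).eval z ≠ 0) : m = r + 1 ∨ m = 2 * r + 1 := by
  by_cases hmr : m ≤ r
  · exfalso
    have hdeg : (gapPoly m r).natDegree = r := by
      refine natDegree_eq_of_le_of_coeff_ne_zero ?_ ?_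
      · rw [natDegree_le_iff_coeff_eq_zero]
        intro k hk
        rw [coeff_gapPoly, if_neg (by omega), if_neg (by omega), sub_zero]
      · rw [coeff_gapPoly, if_neg (by omega), if_pos rfl]
        norm_num
    have hlc : (gapPoly m r).leadingCoeff = -1 := by
      rw [leadingCoeff, hdeg, coeff_gapPoly, if_neg (by omega), if_pos rfl, zero_sub]
    have h := congrArg (fun q => coeff q 0)
      (reverse_gapPoly hm hr (by rw [hlc, norm_neg, norm_one]) hp)
    simp only [coeff_zero_reverse, hlc] at h
    rw [coeff_gapPoly, if_pos (by omega), if_neg (by omega)] at h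
    norm_num at h
  · by_cases h1 : m = r + 1
    · exact Or.inl h1
    right
    have hdeg : (gapPoly m r).natDegree = m - 1 := by
      refine natDegree_eq_of_le_of_coeff_ne_zero ?_ ?_
      · rw [natDegree_le_iff_coeff_eq_zero]
        intro k hk
        rw [coeff_gapPoly, if_neg (by omega), if_neg (by omega), sub_zero]
      · rw [coeff_gapPoly, if_pos (by omega), if_neg (by omega)]
        norm_num
    have hlc : (gapPoly m r).leadingCoeff = 1 := by
      rw [leadingCoeff, hdeg, coeff_gapPoly, if_pos (by omega), if_neg (by omega), sub_zero]
    have h := congrArg (fun q => coeff q r)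
      (reverse_gapPoly hm hr (by rw [hlc, norm_one]) hp)
    simp only [coeff_reverse, hdeg] at h
    rw [revAt_le (by omega), coeff_gapPoly, coeff_gapPoly, if_pos (by omega),
      if_pos (show r < m by omega), if_pos rfl] at h
    by_contra hne
    rw [if_neg (by omega)] at h
    norm_num at h

/-! ### Generating functions in the unit disc -/

/-- The generating function of an integer sequence. -/
noncomputable def genFun (f : ℕ → ℤ) (z : ℂ) : ℂ := ∑' n, (f n : ℂ) * z ^ n

theorem summable_norm_genFun {f : ℕ → ℤ} (hf : ∀ n, |f n| ≤ 1) {z : ℂ} (hz : ‖z‖ < 1) :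
    Summable fun n => ‖(f n : ℂ) * z ^ n‖ := by
  refine Summable.of_nonneg_of_le (fun _ => norm_nonneg _) (fun n => ?_)
    (summable_geometric_of_lt_one (norm_nonneg z) hz)
  rw [norm_mul, norm_pow, Complex.norm_intCast]
  have : |(f n : ℝ)| ≤ 1 := by exact_mod_cast hf n
  nlinarith [pow_nonneg (norm_nonneg z) n]

theorem norm_genFun_le {f : ℕ → ℤ} (hf : ∀ n, |f n| ≤ 1) {z : ℂ} (hz : ‖z‖ < 1) :
    ‖genFun f z‖ ≤ (1 - ‖z‖)⁻¹ := by
  refine tsum_of_norm_bounded (hasSum_geometric_of_lt_one (norm_nonneg z) hz) fun n => ?_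
  rw [norm_mul, norm_pow, Complex.norm_intCast]
  have : |(f n : ℝ)| ≤ 1 := by exact_mod_cast hf n
  nlinarith [pow_nonneg (norm_nonneg z) n]

/-- The constant term has norm at least `1`, the rest at most `‖z‖ / (1 - ‖z‖) < 1`. -/
theorem genFun_ne_zero_of_small {f : ℕ → ℤ} (hf : ∀ n, |f n| ≤ 1) (h0 : f 0 ≠ 0) {z : ℂ}
    (hz : ‖z‖ < 1 / 2) : genFun f z ≠ 0 := by
  have hz1 : ‖z‖ < 1 := by linarith
  have hs := (summable_norm_genFun hf hz1).of_norm
  have hsplit : genFun f z = f 0 + z * genFun (fun n => f (n + 1)) z := by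
    rw [genFun, hs.tsum_eq_zero_add, genFun, ← tsum_mul_left]
    simp only [pow_zero, mul_one, pow_succ]
    congr 2
    funext n
    ring
  intro h
  rw [hsplit] at h
  have hb := norm_genFun_le (f := fun n => f (n + 1)) (fun n => hf _) hz1
  have h1 : (1 : ℝ) ≤ ‖(f 0 : ℂ)‖ := by
    rw [Complex.norm_intCast]
    exact_mod_cast Int.one_le_abs h0
  rw [eq_neg_of_add_eq_zero_left h, norm_neg, norm_mul] at h1
  have h2 : (1 - ‖z‖)⁻¹ ≤ 2 := by
    rw [inv_le_comm₀ (by linarith) (by norm_num)]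
    linarith
  nlinarith [norm_nonneg z, norm_nonneg (genFun (fun n => f (n + 1)) z)]

theorem genFun_mul_of_convEq {f g : ℕ → ℤ} (hf : ∀ n, |f n| ≤ 1) (hg : ∀ n, |g n| ≤ 1)
    (h : ConvEq f g) {z : ℂ} (hz : ‖z‖ < 1) : genFun f z * genFun g z = genFun f (z ^ 2) := by
  rw [genFun, genFun, tsum_mul_tsum_eq_tsum_sum_antidiagonal_of_summable_norm
    (summable_norm_genFun hf hz) (summable_norm_genFun hg hz), genFun]
  have e : ∀ n, ∑ p ∈ Finset.HasAntidiagonal.antidiagonal n,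
      (f p.1 : ℂ) * z ^ p.1 * ((g p.2 : ℂ) * z ^ p.2) =
      if Even n then (f (n / 2) : ℂ) * z ^ n else 0 := by
    intro n
    have h1 := congrArg (fun k : ℤ => (k : ℂ) * z ^ n) (h n)
    simp only [Int.cast_sum, Finset.sum_mul, Int.cast_mul] at h1
    have h2 : (((if Even n then f (n / 2) else 0 : ℤ)) : ℂ) * z ^ n =
      if Even n then (f (n / 2) : ℂ) * z ^ n else 0 := by split_ifs <;> simp
    rw [← h2, ← h1]
    refine Finset.sum_congr rfl fun p hp => ?_
    rw [← Finset.HasAntidiagonal.mem_antidiagonal.1 hp, pow_add]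
    ring
  simp only [e]
  have hinj : Function.Injective fun k : ℕ => 2 * k := fun a b hab => by simpa using hab
  rw [← hinj.tsum_eq]
  · refine tsum_congr fun k => ?_
    rw [if_pos (even_two_mul k), Nat.mul_div_cancel_left _ (by norm_num), pow_mul]
  · intro n hn
    rw [Function.mem_support] at hn
    have : Even n := by
      by_contra hne
      exact hn (if_neg hne)
    obtain ⟨k, rfl⟩ := this
    exact ⟨k, by simp; omega⟩

theorem one_sub_pow_ne_zero {z : ℂ} (hz : ‖z‖ < 1) {m : ℕ} (hm : m ≠ 0) : 1 - z ^ m ≠ 0 := by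
  intro h
  have h1 : ‖z ^ m‖ < 1 := by
    rw [norm_pow]
    exact pow_lt_one₀ (norm_nonneg z) hz hm
  rw [← sub_eq_zero.1 h, norm_one] at h1
  exact lt_irrefl _ h1

open Polynomial in
theorem genFun_progression_compl_mul {m r : ℕ} (hm : 0 < m) {z : ℂ} (hz : ‖z‖ < 1) :
    genFun ((Set.univ \ {n : ℕ | ∃ k, n = r + m * k}).indicator 1) z * (1 - z ^ m) =
      (gapPoly m r).eval z := by
  classical
  have hzm : ‖z ^ m‖ < 1 := by
    rw [norm_pow]
    exact pow_lt_one₀ (norm_nonneg z) hz hm.ne'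
  have h1 := hasSum_geometric_of_norm_lt_one hz
  have hinj : Function.Injective fun k : ℕ => r + m * k := fun a b hab => by
    simpa [hm.ne'] using hab
  have h2 : HasSum (fun n => if ∃ k, n = r + m * k then z ^ n else 0) (z ^ r * (1 - z ^ m)⁻¹) := by
    rw [← hinj.hasSum_iff]
    · have := (hasSum_geometric_of_norm_lt_one hzm).mul_left (z ^ r)
      have e : ((fun n => if ∃ k, n = r + m * k then z ^ n else 0) ∘ fun k => r + m * k) =
          fun k => z ^ r * (z ^ m) ^ k := by
        funext k
        rw [Function.comp_apply, if_pos ⟨k, rfl⟩, pow_add, pow_mul]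
      rw [e]
      exact this
    · intro n hn
      rw [if_neg]
      rintro ⟨k, rfl⟩
      exact hn ⟨k, rfl⟩
  have h3 : genFun ((Set.univ \ {n : ℕ | ∃ k, n = r + m * k}).indicator 1) z =
      (1 - z)⁻¹ - z ^ r * (1 - z ^ m)⁻¹ := by
    rw [genFun, ← (h1.sub h2).tsum_eq]
    refine tsum_congr fun n => ?_
    by_cases h : ∃ k, n = r + m * k <;> simp [Set.indicator, h]
  have hne1 : 1 - z ≠ 0 := by simpa using one_sub_pow_ne_zero hz one_ne_zero
  have hnem := one_sub_pow_ne_zero hz hm.ne'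
  have hgeom := mul_neg_geom_sum z m
  rw [h3, gapPoly]
  simp only [eval_sub, eval_pow, eval_X, eval_finsetSum]
  have e : (1 - z)⁻¹ * (1 - z ^ m) = ∑ i ∈ Finset.range m, z ^ i := by
    rw [← hgeom, inv_mul_cancel_left₀ hne1]
  rw [sub_mul, e, mul_assoc, inv_mul_cancel₀ hnem, mul_one]

/-! ### Nonvanishing and radial growth -/

/-- The functional equation `F(z) P(z) = F(z²) (1 - z ^ m)` in the unit disc. -/
def GapEq (m r : ℕ) (f : ℕ → ℤ) : Prop := ∀ z : ℂ, ‖z‖ < 1 →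
  genFun f z * (gapPoly m r).eval z = genFun f (z ^ 2) * (1 - z ^ m)

theorem norm_sq_lt_one {z : ℂ} (hz : ‖z‖ < 1) : ‖z ^ 2‖ < 1 := by
  rw [norm_pow]
  exact pow_lt_one₀ (norm_nonneg z) hz two_ne_zero

theorem gapEq_of_convEq {m r : ℕ} (hm : 0 < m) {f : ℕ → ℤ} (hf : ∀ n, |f n| ≤ 1)
    (h : ConvEq f ((Set.univ \ {n : ℕ | ∃ k, n = r + m * k}).indicator 1)) : GapEq m r f := by
  classical
  intro z hz
  rw [← genFun_progression_compl_mul hm hz, ← mul_assoc, genFun_mul_of_convEq hf _ h hz]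
  intro n
  rw [Set.indicator_apply]
  split_ifs <;> simp

theorem GapEq.genFun_ne_zero {m r : ℕ} (hm : 0 < m) {f : ℕ → ℤ} (hf : ∀ n, |f n| ≤ 1)
    (h0 : f 0 ≠ 0) (h : GapEq m r f) {z : ℂ} (hz : ‖z‖ < 1) : genFun f z ≠ 0 := by
  intro hzero
  have key : ∀ n : ℕ, genFun f (z ^ 2 ^ n) = 0 := by
    intro n
    induction n with
    | zero => simpa using hzero
    | succ n ih =>
      have hn : ‖z ^ 2 ^ n‖ < 1 := by
        rw [norm_pow]
        exact pow_lt_one₀ (norm_nonneg z) hz (by positivity)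
      have := h _ hn
      rw [ih, zero_mul, ← pow_mul, ← pow_succ] at this
      exact (mul_eq_zero.1 this.symm).resolve_right (one_sub_pow_ne_zero hn hm.ne')
  obtain ⟨n, hn⟩ := exists_pow_lt_of_lt_one (show (0 : ℝ) < 1 / 2 by norm_num) hz
  refine genFun_ne_zero_of_small hf h0 ?_ (key n)
  rw [norm_pow]
  exact (pow_le_pow_of_le_one (norm_nonneg z) hz.le Nat.lt_two_pow_self.le).trans_lt hn

theorem GapEq.gapPoly_ne_zero {m r : ℕ} (hm : 0 < m) {f : ℕ → ℤ} (hf : ∀ n, |f n| ≤ 1)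
    (h0 : f 0 ≠ 0) (h : GapEq m r f) {z : ℂ} (hz : ‖z‖ < 1) : (gapPoly m r).eval z ≠ 0 := by
  intro hzero
  have := h z hz
  rw [hzero, mul_zero] at this
  exact mul_ne_zero (h.genFun_ne_zero hm hf h0 (norm_sq_lt_one hz))
    (one_sub_pow_ne_zero hz hm.ne') this.symm

/-- Nontrivial `d`-th roots of unity cannot all be zeros of `gapPoly m r`. -/
theorem GapEq.false_of_roots {m r d : ℕ} (hm : 0 < m) {f : ℕ → ℤ} (hf : ∀ n, |f n| ≤ 1)
    (h0 : f 0 ≠ 0) (h : GapEq m r f) (hd : Odd d) (hd1 : d ≠ 1)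
    (hroot : ∀ η : ℂ, η ^ d = 1 → η ≠ 1 → (gapPoly m r).eval η = 0)
    (hpow : ∀ η : ℂ, η ^ d = 1 → η ≠ 1 → η ^ m ≠ 1) : False := by
  have hdpos : 0 < d := hd.pos
  set Ω : Set ℂ := {η | η ^ d = 1 ∧ η ≠ 1} with hΩ
  have hnorm : ∀ η ∈ Ω, ‖η‖ = 1 := fun η hη => Complex.norm_eq_one_of_pow_eq_one hη.1 hdpos.ne'
  -- Squaring preserves `Ω` because `d` is odd.
  have hsq : ∀ η ∈ Ω, η ^ 2 ∈ Ω := by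
    rintro η ⟨h1, h2⟩
    refine ⟨by rw [← pow_mul, mul_comm, pow_mul, h1, one_pow], fun h3 => h2 ?_⟩
    obtain ⟨k, hk⟩ := hd
    rw [hk, pow_succ, pow_mul, h3, one_pow, one_mul] at h1
    exact h1
  have hfin : Ω.Finite := by
    refine (Polynomial.nthRootsFinset d (1 : ℂ)).finite_toSet.subset fun η hη => ?_
    rw [Finset.mem_coe, Polynomial.mem_nthRootsFinset hdpos]
    exact hη.1
  have hprim := Complex.isPrimitiveRoot_exp d hdpos.ne'
  obtain ⟨η₀, hη₀⟩ : Ω.Nonempty := ⟨_, hprim.pow_eq_one, hprim.ne_one (by omega)⟩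
  -- At `η` the left side is `0` and the right side is positive. Any factor above `2` would serve in
  -- place of `4`.
  have hev : ∀ η ∈ Ω, ∀ᶠ ρ : ℝ in nhds 1,
      4 * ‖(gapPoly m r).eval ((ρ : ℂ) * η)‖ < ‖1 - ((ρ : ℂ) * η) ^ m‖ := by
    rintro η ⟨h1, h2⟩
    have hc1 : Continuous fun ρ : ℝ => 4 * ‖(gapPoly m r).eval ((ρ : ℂ) * η)‖ := by fun_prop
    have hc2 : Continuous fun ρ : ℝ => ‖1 - ((ρ : ℂ) * η) ^ m‖ := by fun_prop
    refine hc1.continuousAt.eventually_lt hc2.continuousAt ?_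
    simp only [Complex.ofReal_one, one_mul, hroot η h1 h2, norm_zero, mul_zero, norm_pos_iff]
    exact sub_ne_zero.2 (hpow η h1 h2).symm
  have hev2 := (Filter.eventually_all_finite hfin).2 hev
  obtain ⟨ε, hε, hball⟩ := Metric.eventually_nhds_iff.1 hev2
  set ρ₀ : ℝ := max (1 / 2) (1 - ε / 2) with hρ₀
  have hρ₀1 : ρ₀ < 1 := max_lt (by norm_num) (by linarith)
  have hρ₀0 : 1 / 2 ≤ ρ₀ := le_max_left _ _
  have hρ₀e : 1 - ε / 2 ≤ ρ₀ := le_max_right _ _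
  have hstep : ∀ ρ : ℝ, ρ₀ ≤ ρ → ρ < 1 → ∀ η ∈ Ω,
      4 * ‖genFun f (((ρ ^ 2 : ℝ) : ℂ) * η ^ 2)‖ ≤ ‖genFun f ((ρ : ℂ) * η)‖ := by
    intro ρ h1 h2 η hη
    have hlt := hball (y := ρ) (by rw [Real.dist_eq, abs_lt]; constructor <;> linarith) η hη
    have hz : ‖(ρ : ℂ) * η‖ < 1 := by
      rw [norm_mul, hnorm η hη, mul_one, Complex.norm_real, Real.norm_of_nonneg (by linarith)]
      exact h2
    have he := congrArg norm (h _ hz)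
    rw [norm_mul, norm_mul, mul_pow] at he
    have hP := norm_pos_iff.2 (h.gapPoly_ne_zero hm hf h0 hz)
    push_cast
    refine le_of_mul_le_mul_right ?_ hP
    rw [he]
    nlinarith [norm_nonneg (genFun f ((ρ : ℂ) ^ 2 * η ^ 2))]
  obtain ⟨η₁, hη₁, hmin⟩ := hfin.toFinset.exists_min_image (fun η => ‖genFun f ((ρ₀ : ℂ) * η)‖)
    ⟨η₀, hfin.mem_toFinset.2 hη₀⟩
  have hη₁' := hfin.mem_toFinset.1 hη₁
  set c := ‖genFun f ((ρ₀ : ℂ) * η₁)‖ with hc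
  have hcpos : 0 < c := by
    refine norm_pos_iff.2 (h.genFun_ne_zero hm hf h0 ?_)
    rw [norm_mul, hnorm η₁ hη₁', mul_one, Complex.norm_real, Real.norm_of_nonneg (by linarith)]
    exact hρ₀1
  -- Passing from `ρ` to `√ρ` multiplies the lower bound by `4`, while `1 - √ρ ≥ (1 - ρ) / 2` lets
  -- the upper bound `(1 - ρ)⁻¹` at most double.
  have hgrow : ∀ n : ℕ, ∃ ρ : ℝ, ρ₀ ≤ ρ ∧ ρ < 1 ∧ 1 - ρ₀ ≤ 2 ^ n * (1 - ρ) ∧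
      ∀ η ∈ Ω, 4 ^ n * c ≤ ‖genFun f ((ρ : ℂ) * η)‖ := by
    intro n
    induction n with
    | zero =>
      refine ⟨ρ₀, le_rfl, hρ₀1, by simp, fun η hη => ?_⟩
      simpa using hmin η (hfin.mem_toFinset.2 hη)
    | succ n ih =>
      obtain ⟨ρ, h1, h2, h3, h4⟩ := ih
      have hs : √ρ ^ 2 = ρ := Real.sq_sqrt (by linarith)
      have hs1 : √ρ < 1 := by
        rw [Real.sqrt_lt' one_pos]
        linarith
      have hs2 : ρ ≤ √ρ := by nlinarith [Real.sqrt_nonneg ρ]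
      refine ⟨√ρ, h1.trans hs2, hs1, ?_, fun η hη => ?_⟩
      · have : 1 - ρ ≤ 2 * (1 - √ρ) := by nlinarith [Real.sqrt_nonneg ρ]
        calc 1 - ρ₀ ≤ 2 ^ n * (1 - ρ) := h3
          _ ≤ 2 ^ n * (2 * (1 - √ρ)) := by gcongr
          _ = 2 ^ (n + 1) * (1 - √ρ) := by ring
      · have h5 := hstep (√ρ) (h1.trans hs2) hs1 η hη
        rw [hs] at h5
        calc 4 ^ (n + 1) * c = 4 * (4 ^ n * c) := by ring
          _ ≤ 4 * ‖genFun f ((ρ : ℂ) * η ^ 2)‖ := by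
            gcongr
            exact h4 _ (hsq η hη)
          _ ≤ _ := h5
  have hc' : 0 < c * (1 - ρ₀) := mul_pos hcpos (by linarith)
  obtain ⟨n, hn⟩ := pow_unbounded_of_one_lt (c * (1 - ρ₀))⁻¹ (one_lt_two (α := ℝ))
  obtain ⟨ρ, h1, h2, h3, h4⟩ := hgrow n
  have hz : ‖(ρ : ℂ) * η₀‖ = ρ := by
    rw [norm_mul, hnorm η₀ hη₀, mul_one, Complex.norm_real, Real.norm_of_nonneg (by linarith)]
  have hle := (h4 η₀ hη₀).trans (norm_genFun_le hf (by rw [hz]; exact h2))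
  rw [hz, le_inv_comm₀ (by positivity) (by linarith)] at hle
  have h6 : 2 ^ n * (c * (1 - ρ₀)) ≤ 1 := by
    have h7 : (1 - ρ) * (4 ^ n * c) ≤ 1 := by
      rw [← le_div_iff₀ (by positivity), one_div]
      exact hle
    have h8 : (4 : ℝ) ^ n = 2 ^ n * 2 ^ n := by rw [← mul_pow]; norm_num
    calc 2 ^ n * (c * (1 - ρ₀)) ≤ 2 ^ n * (c * (2 ^ n * (1 - ρ))) := by gcongr
      _ = (1 - ρ) * (4 ^ n * c) := by rw [h8]; ring
      _ ≤ 1 := h7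
  have h9 := (inv_lt_iff_one_lt_mul₀ hc').1 hn
  linarith

open Polynomial in
theorem GapEq.exists_two_pow {m r : ℕ} (hm : 2 ≤ m) (hr : 1 ≤ r) {f : ℕ → ℤ}
    (hf : ∀ n, |f n| ≤ 1) (h0 : f 0 ≠ 0) (h : GapEq m r f) :
    ∃ l, r = 2 ^ l ∧ (m = 2 ^ l + 1 ∨ m = 2 ^ (l + 1) + 1) := by
  have hcase := eq_of_gapPoly_ne_zero hm hr fun z hz => h.gapPoly_ne_zero (by omega) hf h0 hz
  obtain ⟨s, hs⟩ : ∃ s, m = r * s + 1 := by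
    rcases hcase with hc | hc
    · exact ⟨1, by omega⟩
    · exact ⟨2, by omega⟩
  obtain ⟨l, d, hd, hrd⟩ := Nat.exists_eq_two_pow_mul_odd (show r ≠ 0 by omega)
  have hd1 : d = 1 := by
    by_contra hd1
    -- For such `η`, `η ^ r = 1` and `η ^ m = η`, since `d ∣ r ∣ m - 1`; if also `η ≠ 1`, then `P(η)
    -- = (η ^ m - 1) / (η - 1) - η ^ r = 0`.
    have hr1 : ∀ η : ℂ, η ^ d = 1 → η ^ r = 1 := fun η hη => by
      rw [hrd, mul_comm, pow_mul, hη, one_pow]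
    have hm1 : ∀ η : ℂ, η ^ d = 1 → η ^ m = η := fun η hη => by
      rw [hs, pow_succ, pow_mul, hr1 η hη, one_pow, one_mul]
    refine h.false_of_roots (by omega) hf h0 hd hd1 (fun η h1 h2 => ?_) fun η h1 h2 => ?_
    · simp only [gapPoly, eval_sub, eval_pow, eval_X, eval_finsetSum]
      rw [geom_sum_eq h2, hm1 η h1, hr1 η h1, div_self (sub_ne_zero.2 h2), sub_self]
    · rw [hm1 η h1]
      exact h2
  rw [hd1, mul_one] at hrd
  refine ⟨l, hrd, ?_⟩
  rw [pow_succ, ← hrd]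
  omega

/-! ### Assembling the classification -/

theorem abs_signFn_le (A B : Set ℕ) (n : ℕ) : |signFn A B n| ≤ 1 := by
  by_cases h1 : n ∈ A <;> by_cases h2 : n ∈ B <;> simp [signFn, h1, h2]

theorem repr2_S1 (l n : ℕ) : repr2 (S1 l) n = repr2 (T1 l) n :=
  repr2_evenSums_eq (seq1_sum_injective l) n

theorem repr2_S2 (l n : ℕ) : repr2 (S2 l) n = repr2 (T2 l) n :=
  repr2_evenSums_eq (seq2_sum_injective l) n

theorem IsListedPair.repr2_eq {l : ℕ} {A B : Set ℕ} (h : IsListedPair l A B) (n : ℕ) :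
    repr2 A n = repr2 B n := by
  rcases h with ⟨rfl, rfl⟩ | ⟨rfl, rfl⟩ | ⟨rfl, rfl⟩
  · exact repr2_S1 l n
  · exact repr2_S2 l n
  · exact repr2_shiftOne_congr (repr2_S1 l) n

theorem zero_mem_progression_compl {m r : ℕ} (hr : 1 ≤ r) :
    0 ∈ Set.univ \ {n : ℕ | ∃ k : ℕ, n = r + m * k} := by
  refine ⟨Set.mem_univ _, ?_⟩
  rintro ⟨k, hk⟩
  omega

/-- The classification when the progression omits `0`. -/
theorem exists_eq_of_repr2_eq {m r : ℕ} (hm : 2 ≤ m) (hr : 1 ≤ r) {A B : Set ℕ}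
    (hunion : A ∪ B = Set.univ \ {n : ℕ | ∃ k : ℕ, n = r + m * k}) (hinter : A ∩ B = ∅)
    (h : ∀ n, repr2 A n = repr2 B n) (h0 : 0 ∈ A) :
    ∃ l, r = 2 ^ l ∧ ((m = 2 ^ l + 1 ∧ A = S1 l ∧ B = T1 l) ∨
      (m = 2 ^ (l + 1) + 1 ∧ A = S2 (l + 1) ∧ B = T2 (l + 1))) := by
  have hB : 0 ∉ B := fun hb => by
    have : 0 ∈ A ∩ B := ⟨h0, hb⟩
    simp [hinter] at this
  have hconv := convEq_of_repr2_eq h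
  simp only [indicator_add_indicator hunion hinter] at hconv
  obtain ⟨l, hl, hml⟩ := (gapEq_of_convEq (by omega) (abs_signFn_le A B) hconv).exists_two_pow hm hr
    (abs_signFn_le A B) (by simp [signFn, h0, hB])
  refine ⟨l, hl, ?_⟩
  have hU := zero_mem_progression_compl (m := m) hr
  rcases hml with hml | hml
  · refine Or.inl ⟨hml, partition_unique hU hunion hinter ?_ ?_ h (repr2_S1 l) h0
      (zero_mem_evenSums _)⟩
    · rw [S1, T1, evenSums_union_oddSums, range_seq1_sum, hl, hml]
    · exact evenSums_inter_oddSums (seq1_sum_injective l)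
  · refine Or.inr ⟨hml, partition_unique hU hunion hinter ?_ ?_ h (repr2_S2 (l + 1)) h0
      (zero_mem_evenSums _)⟩
    · rw [S2, T2, evenSums_union_oddSums, range_seq2_sum, hl, hml]
    · exact evenSums_inter_oddSums (seq2_sum_injective (l + 1))

theorem shiftOne_preimage {A : Set ℕ} (h : 0 ∉ A) : shiftOne {n | n + 1 ∈ A} = A := by
  ext n
  constructor
  · rintro ⟨s, hs, rfl⟩
    exact hs
  · intro hn
    rcases n with _ | n
    · exact absurd hn h
    · exact ⟨n, hn, rfl⟩

theorem progression_compl_succ {m : ℕ} (hm : 2 ≤ m) (n : ℕ) :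
    n + 1 ∈ Set.univ \ {n : ℕ | ∃ k : ℕ, n = 0 + m * k} ↔
      n ∈ Set.univ \ {n : ℕ | ∃ k : ℕ, n = m - 1 + m * k} := by
  simp only [Set.mem_sdiff, Set.mem_univ, true_and, Set.mem_ofPred_eq, not_iff_not]
  constructor
  · rintro ⟨k, hk⟩
    rcases k with _ | k
    · simp at hk
    · exact ⟨k, by rw [mul_add] at hk; omega⟩
  · rintro ⟨k, hk⟩
    exact ⟨k + 1, by rw [mul_add]; omega⟩

/-- The number `if r = 0 then 1 else 0` is the least element of `A ∪ B`; its membership in `A` fixes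
the order of the pair. -/
theorem exists_isListedPair_of_mem {m r : ℕ} (hm : 2 ≤ m) {A B : Set ℕ}
    (hunion : A ∪ B = Set.univ \ {n : ℕ | ∃ k : ℕ, n = r + m * k}) (hinter : A ∩ B = ∅)
    (h : ∀ n, repr2 A n = repr2 B n) (h0 : (if r = 0 then 1 else 0) ∈ A) :
    ∃ l, IsListedPair l A B := by
  by_cases hr : r = 0
  · subst hr
    rw [if_pos rfl] at h0
    have hnot : 0 ∉ A ∪ B := by
      rw [hunion]
      exact fun h => h.2 ⟨0, rfl⟩
    have hA := shiftOne_preimage fun ha => hnot (Or.inl ha)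
    have hB := shiftOne_preimage fun hb => hnot (Or.inr hb)
    obtain ⟨l, hl, ⟨-, h1, h2⟩ | ⟨hm', -⟩⟩ := exists_eq_of_repr2_eq (r := m - 1) hm (by omega)
      (A := {n | n + 1 ∈ A}) (B := {n | n + 1 ∈ B})
      (by
        ext n
        rw [← progression_compl_succ hm, ← hunion]
        rfl)
      (by
        ext n
        have : n + 1 ∉ A ∩ B := by simp [hinter]
        simpa using this)
      (fun n => by rw [← repr2_shiftOne_add_two, hA, h, ← repr2_shiftOne_add_two {n | n + 1 ∈ B}, hB])
      h0
    · exact ⟨l, Or.inr (Or.inr ⟨by rw [← h1, hA], by rw [← h2, hB]⟩)⟩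
    -- After translation `r = m - 1`, so the second family would need `2 ^ l = m - 1 = 2 ^ (l + 1)`.
    · have := Nat.one_le_two_pow (n := l)
      rw [pow_succ] at hm'
      omega
  · rw [if_neg hr] at h0
    obtain ⟨l, -, ⟨-, h1⟩ | ⟨-, h1⟩⟩ := exists_eq_of_repr2_eq hm (by omega) hunion hinter h h0
    · exact ⟨l, Or.inl h1⟩
    · exact ⟨l + 1, Or.inr (Or.inl h1)⟩

theorem theorem1p1 (m r : ℕ) (hm : 2 ≤ m) (A B : Set ℕ)
    (hunion : A ∪ B = Set.univ \ {n : ℕ | ∃ k : ℕ, n = r + m * k})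
    (hinter : A ∩ B = ∅) :
    (∀ n : ℕ, 0 < n → repr2 A n = repr2 B n) ↔
      ∃ l : ℕ, IsListedPair l A B ∨ IsListedPair l B A := by
  constructor
  · intro h
    have h' : ∀ n, repr2 A n = repr2 B n := fun n => by
      rcases Nat.eq_zero_or_pos n with rfl | hn
      · rw [repr2_zero, repr2_zero]
      · exact h n hn
    have hmem : (if r = 0 then 1 else 0) ∈ A ∪ B := by
      rw [hunion]
      split_ifs with hr
      · refine ⟨Set.mem_univ _, ?_⟩
        rintro ⟨k, hk⟩
        rw [hr, zero_add] at hk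
        have := Nat.eq_one_of_mul_eq_one_right hk.symm
        omega
      · exact zero_mem_progression_compl (by omega)
    rcases hmem with h0 | h0
    · obtain ⟨l, hl⟩ := exists_isListedPair_of_mem hm hunion hinter h' h0
      exact ⟨l, Or.inl hl⟩
    · rw [Set.union_comm] at hunion
      rw [Set.inter_comm] at hinter
      obtain ⟨l, hl⟩ := exists_isListedPair_of_mem hm hunion hinter (fun n => (h' n).symm) h0
      exact ⟨l, Or.inr hl⟩
  · rintro ⟨l, hl | hl⟩ n -
    · exact hl.repr2_eq n
    · exact (hl.repr2_eq n).symm
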